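/- **Setting.** An instance of MAX-$k$-XOR-SAT is a pair $(B,v)$ with $B\in\mathbb F_2^{m\times n}$, $v\in\mathbb F_2^m$; a bit string $z\in\mathbb F_2^n$ satisfies $g(z)=m-\lVert Bz\oplus v\rVert_1$ of its $m$ clauses. Let $\lambda>1$ be fixed, let $k\ge 3$ be such that $d=\lambda k$ is an integer, and let $m=dN$, $n=kN$ with $N\in\mathbb N$ (so $m=\lambda n$). The Gallager ensemble $\mathcal G(m,k,d)$ is the law of the parity check matrix $H\in\mathbb F_2^{n\times m}$ whose Tanner graph is obtained by taking $k$ independent uniformly random $(1,d)$-regular bipartite graphs (layers) with the same $m$ left nodes and with $m/d$ right nodes each, and uniting them along the left nodes. The transposed Gallager ensemble $\mathbb P_1$ is the law of $(B,v)$ with $B^{\mathsf T}\sim\mathcal G(m,k,d)$ and $v$ uniform on $\mathbb F_2^m$, independent of $B$. **Algorithm.** For $0\le \ell\le m$, $\mathrm{DQI}_\ell$ has as parameters real weights $w_0,\dots,w_\ell$ with $\sum_j w_j^2=1$, which do not depend on the instance, and a decoder $D_B:\mathbb F_2^n\to\mathbb F_2^m$. It prepares $\sum_{j\le\ell}w_j|D^m_j\rangle$,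 where $|D^m_j\rangle=\binom mj^{-1/2}\sum_{|y|=j}|y\rangle$, applies $\bigotimes_i Z^{v_i}$, computes the syndrome $|y\rangle\mapsto|y\rangle|B^{\mathsf T}y\rangle$, applies the decoder $|y\rangle|s\rangle\mapsto|y\oplus D_B(s)\rangle|s\rangle$, applies the Hadamard transform to the syndrome register, and measures this register in the computational basis. If $D_B$ corrects all errors of weight at most $\ell$, that is, $D_B(B^{\mathsf T}y)=y$ whenever $|y|\le\ell$, the measured state is $|\mathrm{DQI}_\ell(f)\rangle\propto\sum_x P(f(x))|x\rangle$ with $f(x)=m-2\lVert Bx\oplus v\rVert_1$ and $P$ the polynomial of degree at most $\ell$ defined by $P(\sum_i z_i)=\sum_{j\le\ell}w_j\binom mj^{-1/2}\sum_{|y|=j}\prod_i z_i^{y_i}$ for $z\in\{\pm1\}^m$. Let $H_2(x)=-x\log_2x-(1-x)\log_2(1-x)$ and let $H_2^{-1}:[0,1]\to[0,1/2]$ be its inverse. **Theorem (DQI is topologically obstructed for transposed Gallager MAX-$k$-XOR-SAT).** Fix $\lambda>1$, $c^\ast\ge1$ and a sequence $\varepsilon_1(k)\to0$ as $k\to\infty$.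 There are sequences $\varepsilon_2(k)\to0$ and $\varepsilon_3(k)\to0$ as $k\to\infty$ such that for all integers $k\ge3$ with $d=\lambda k$ an integer and $c^\ast\le k\lambda$ the following holds. The number $(1+\varepsilon_2(k))\frac{4c^\ast\log_2k}{k\lambda}$ lies in $[0,1]$, and $$\mu_{\mathrm{top}}:=1-H_2^{-1}\Bigl(1-(1+\varepsilon_2(k))\frac{4c^\ast\log_2k}{k\lambda}\Bigr)=\frac12+(1+\varepsilon_3(k))\sqrt{\frac{2c^\ast\ln k}{k\lambda}} .$$ There is an $n_0$ such that for all $n=kN\ge n_0$, with $m=\lambda n=dN$, for all $\ell\le m$ with $$\frac{\ell}{m}\le(1+\varepsilon_1(k))\,H_2^{-1}\Bigl(\frac{c^\ast}{k\lambda}\Bigr),$$ for all weights $w_0,\dots,w_\ell$ and for all decoders (in particular those that correct all errors of weight at most $\ell$ wherever the code allows it), the probability, over both $(B,v)\sim\mathbb P_1$ and the measurement, that $\mathrm{DQI}_\ell$ outputs a bit string $z$ with $g(z)/m>\mu_{\mathrm{top}}$ is at most $12/13$. -/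

import Mathlib

open scoped BigOperators Topology
open Filter

noncomputable section

namespace DQI

/-! ### Binary entropy -/

/-- The binary entropy `H₂ x = -x log₂ x - (1 - x) log₂ (1 - x)`, in bits. -/
def H₂ (x : ℝ) : ℝ := Real.binEntropy x / Real.log 2

/-- The inverse `H₂⁻¹ : [0, 1] → [0, 1/2]` of the binary entropy
(values outside `[0, 1]` carry no meaning). -/
def H₂inv (y : ℝ) : ℝ := Function.invFunOn H₂ (Set.Icc 0 (1 / 2)) y

theorem H₂inv_spec {y : ℝ} (hy : y ∈ Set.Icc (0 : ℝ) 1) :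
    H₂inv y ∈ Set.Icc (0 : ℝ) (1 / 2) ∧ H₂ (H₂inv y) = y := by
  have h2 : Real.log 2 ≠ 0 := (Real.log_pos one_lt_two).ne'
  have hc : ContinuousOn H₂ (Set.Icc 0 (1 / 2)) :=
    (Real.binEntropy_continuous.div_const _).continuousOn
  have h0 : H₂ 0 = 0 := by simp [H₂]
  have h1 : H₂ (1 / 2) = 1 := by
    have : Real.binEntropy (1 / 2) = Real.log 2 := by
      rw [one_div]; exact Real.binEntropy_two_inv
    rw [H₂, this, div_self h2]
  have himg : y ∈ H₂ '' Set.Icc 0 (1 / 2) := by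
    apply intermediate_value_Icc (by norm_num) hc
    rw [h0, h1]; exact hy
  exact ⟨Function.invFunOn_mem himg, Function.invFunOn_eq himg⟩

/-! ### MAX-XOR-SAT

An instance has `m` clauses and variables indexed by a finite type `V`: a constraint matrix
`B ∈ 𝔽₂^{m × V}` and a vector of parities `v ∈ 𝔽₂^m`. -/

variable {m : ℕ} {V : Type*} [Fintype V] [DecidableEq V]

/-- The number `g(z) = m - ‖B z ⊕ v‖₁` of satisfied clauses. -/
def numSat (B : Matrix (Fin m) V (ZMod 2)) (v : Fin m → ZMod 2) (z : V → ZMod 2) : ℝ :=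
  (m : ℝ) - (hammingNorm (B.mulVec z + v) : ℝ)

/-- `f(z) = m - 2 ‖B z ⊕ v‖₁`, satisfied minus violated clauses. -/
def excess (B : Matrix (Fin m) V (ZMod 2)) (v : Fin m → ZMod 2) (z : V → ZMod 2) : ℝ :=
  (m : ℝ) - 2 * (hammingNorm (B.mulVec z + v) : ℝ)

/-! ### The transposed Gallager ensemble -/

/-- A `(1, d)`-regular bipartite graph with `d * N` left nodes and `N` right nodes, given by the
map that sends a left node to its unique neighbour: every right node has degree `d`. -/
abbrev Layer (d N : ℕ) : Type :=
  {h : Fin (d * N) → Fin N // ∀ j, (Finset.univ.filter fun i => h i = j).card = d}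

instance (d N : ℕ) : Nonempty (Layer d N) := by
  refine ⟨⟨fun i => (finProdFinEquiv.symm i).2, fun j => ?_⟩⟩
  have : (Finset.univ.filter fun i : Fin (d * N) => (finProdFinEquiv.symm i).2 = j)
      = Finset.univ.map ⟨fun a : Fin d => finProdFinEquiv (a, j), fun a b h => by
          have := finProdFinEquiv.injective h
          exact (Prod.mk.inj this).1⟩ := by
    ext i
    simp only [Finset.mem_filter, Finset.mem_univ, true_and, Finset.mem_map]
    constructor
    · intro h
      refine ⟨(finProdFinEquiv.symm i).1, ?_⟩
      rw [← h]
      exact finProdFinEquiv.apply_symm_apply i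
    · rintro ⟨a, rfl⟩
      change (finProdFinEquiv.symm (finProdFinEquiv (a, j))).2 = j
      rw [Equiv.symm_apply_apply]
  rw [this]
  simp

/-- The `k` layers from which a Gallager code on `m = d * N` bits with `n = k * N` checks is
merged. In the ensemble `𝒢(m, k, d)` the layers are independent and uniform, that is,
the tuple is uniform on this finite type. -/
abbrev Layers (k d N : ℕ) : Type := Fin k → Layer d N

/-- The parity check matrix `H = Bᵀ` of the merged graph: check `(i, j)` is right node `j` of
layer `i`. -/
def parityCheck {k d N : ℕ} (G : Layers k d N) :
    Matrix (Fin k × Fin N) (Fin (d * N)) (ZMod 2) :=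
  Matrix.of fun c b => if (G c.1).1 b = c.2 then 1 else 0

/-! ### Decoded Quantum Interferometry

The state is followed through the steps of the algorithm. A (not necessarily normalized) state of
a register whose basis states are indexed by `ι` is its amplitude function `ι → ℂ`. -/

/-- The sign `(-1)^a`, `a ∈ 𝔽₂`. -/
def sgn (a : ZMod 2) : ℝ := (-1) ^ a.val

/-- The Dicke state `|D^m_j⟩ = binom(m,j)^{-1/2} ∑_{|y| = j} |y⟩`. -/
def dicke (m j : ℕ) (y : Fin m → ZMod 2) : ℂ :=
  if hammingNorm y = j then (1 / Real.sqrt (m.choose j) : ℝ) else 0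

/-- The instance-independent resource state `∑_{j ≤ ℓ} w_j |D^m_j⟩`. -/
def resource (m ℓ : ℕ) (w : ℕ → ℝ) (y : Fin m → ZMod 2) : ℂ :=
  ∑ j ∈ Finset.range (ℓ + 1), (w j : ℂ) * dicke m j y

/-- Apply `⨂ᵢ Z^{vᵢ}`. -/
def phase (v : Fin m → ZMod 2) (ψ : (Fin m → ZMod 2) → ℂ) (y : Fin m → ZMod 2) : ℂ :=
  (sgn (v ⬝ᵥ y) : ℂ) * ψ y

/-- Compute the syndrome in a new register: `|y⟩ ↦ |y⟩|Bᵀ y⟩`. -/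
def addSyndrome (B : Matrix (Fin m) V (ZMod 2)) (ψ : (Fin m → ZMod 2) → ℂ)
    (p : (Fin m → ZMod 2) × (V → ZMod 2)) : ℂ :=
  if p.2 = B.transpose.mulVec p.1 then ψ p.1 else 0

/-- Run the decoder `D` reversibly on the syndrome register and add its output to the error
register: `|y⟩|s⟩ ↦ |y ⊕ D(s)⟩|s⟩`. If `D` corrects the errors in the support of the state, this
resets the error register to `|0⟩`. -/
def uncompute (D : (V → ZMod 2) → (Fin m → ZMod 2))
    (φ : (Fin m → ZMod 2) × (V → ZMod 2) → ℂ) (p : (Fin m → ZMod 2) × (V → ZMod 2)) : ℂ :=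
  φ (p.1 + D p.2, p.2)

/-- Hadamard transform of the syndrome register. -/
def hadamard (φ : (Fin m → ZMod 2) × (V → ZMod 2) → ℂ)
    (p : (Fin m → ZMod 2) × (V → ZMod 2)) : ℂ :=
  ((1 / Real.sqrt (2 ^ Fintype.card V) : ℝ) : ℂ) *
    ∑ s : V → ZMod 2, (sgn (p.2 ⬝ᵥ s) : ℂ) * φ (p.1, s)

/-- The final state of `DQI_ℓ` with resource weights `w` and decoder `D` on the instance
`(B, v)`. -/
def finalState (ℓ : ℕ) (w : ℕ → ℝ) (D : (V → ZMod 2) → (Fin m → ZMod 2))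
    (B : Matrix (Fin m) V (ZMod 2)) (v : Fin m → ZMod 2) :
    (Fin m → ZMod 2) × (V → ZMod 2) → ℂ :=
  hadamard (uncompute D (addSyndrome B (phase v (resource m ℓ w))))

/-- The probability (Born rule) that measuring the output register of the final state in the
computational basis gives the bit string `x`. -/
def outputProb (ℓ : ℕ) (w : ℕ → ℝ) (D : (V → ZMod 2) → (Fin m → ZMod 2))
    (B : Matrix (Fin m) V (ZMod 2)) (v : Fin m → ZMod 2) (x : V → ZMod 2) : ℝ :=
  ∑ u : Fin m → ZMod 2, ‖finalState ℓ w D B v (u, x)‖ ^ 2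

theorem sgn_eq (a : ZMod 2) : sgn a = if a = 0 then 1 else -1 := by
  have h : ∀ a : ZMod 2, a.val = if a = 0 then 0 else 1 := by decide
  rw [sgn, h]
  split_ifs <;> norm_num

theorem sgn_add (a b : ZMod 2) : sgn (a + b) = sgn a * sgn b := by
  have h : ∀ a b : ZMod 2, a + b = 0 ↔ (a = 0 ↔ b = 0) := by decide
  simp only [sgn_eq, h]
  by_cases ha : a = 0 <;> by_cases hb : b = 0 <;> simp [ha, hb]

theorem resource_eq_zero {ℓ : ℕ} {w : ℕ → ℝ} {y : Fin m → ZMod 2} (hy : ¬ hammingNorm y ≤ ℓ) :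
    resource m ℓ w y = 0 := by
  apply Finset.sum_eq_zero
  intro j hj
  have : hammingNorm y ≠ j := by
    rintro rfl
    exact hy (Nat.lt_succ_iff.mp (Finset.mem_range.mp hj))
  simp [dicke, this]

theorem excess_eq (B : Matrix (Fin m) V (ZMod 2)) (v : Fin m → ZMod 2) (x : V → ZMod 2) :
    excess B v x = ∑ i, sgn ((B.mulVec x + v) i) := by
  have key : ∀ a : ZMod 2, sgn a = 1 - 2 * (if a ≠ 0 then (1 : ℝ) else 0) := by
    intro a
    rw [sgn_eq]
    by_cases ha : a = 0
    · simp [ha]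
    · simp only [ha, if_false, ne_eq, not_false_eq_true, if_true]; norm_num
  simp only [key, Finset.sum_sub_distrib, ← Finset.mul_sum, excess, hammingNorm,
    Finset.sum_boole]
  simp

/-- The output of `DQI_ℓ` when the decoder corrects all errors of weight at most `ℓ`: if
`P(∑ᵢ zᵢ) = ∑_{j ≤ ℓ} w_j binom(m,j)^{-1/2} ∑_{|y| = j} ∏ᵢ zᵢ^{yᵢ}` for all signs `z`, the final
state is `2^{-n/2} ∑_x P(f(x)) |x⟩`. -/
theorem outputProb_of_corrects {ℓ : ℕ} {w : ℕ → ℝ} {D : (V → ZMod 2) → (Fin m → ZMod 2)}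
    {B : Matrix (Fin m) V (ZMod 2)} {v : Fin m → ZMod 2}
    (hD : ∀ y, hammingNorm y ≤ ℓ → D (B.transpose.mulVec y) = y) (P : Polynomial ℝ)
    (hP : ∀ z : Fin m → ZMod 2, P.eval (∑ i, sgn (z i)) =
      ∑ j ∈ Finset.range (ℓ + 1), w j * (1 / Real.sqrt (m.choose j)) *
        ∑ y : Fin m → ZMod 2 with hammingNorm y = j, sgn (z ⬝ᵥ y)) (x : V → ZMod 2) :
    outputProb ℓ w D B v x = P.eval (excess B v x) ^ 2 / 2 ^ Fintype.card V := by
  set ψ := phase v (resource m ℓ w) with hψ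
  have hψ0 : ∀ y, ψ y ≠ 0 → hammingNorm y ≤ ℓ := by
    intro y hy
    by_contra h
    exact hy (by simp [hψ, phase, resource_eq_zero h])
  have hU : ∀ u, u ≠ 0 → finalState ℓ w D B v (u, x) = 0 := by
    intro u hu
    simp only [finalState, hadamard, uncompute, addSyndrome]
    rw [Finset.sum_eq_zero, mul_zero]
    intro s _
    split_ifs with h
    · by_cases hz : ψ (u + D s) = 0
      · rw [← hψ, hz, mul_zero]
      · exfalso
        have h1 := hD _ (hψ0 _ hz)
        rw [← h] at h1
        exact hu (by simpa using h1)
    · simp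
  have h0 : finalState ℓ w D B v (0, x) =
      ((1 / Real.sqrt (2 ^ Fintype.card V) * P.eval (excess B v x) : ℝ) : ℂ) := by
    have hsum : ∑ s : V → ZMod 2, (sgn (x ⬝ᵥ s) : ℂ) *
          uncompute D (addSyndrome B ψ) (0, s) =
        ∑ y : Fin m → ZMod 2, (sgn (x ⬝ᵥ B.transpose.mulVec y) : ℂ) * ψ y := by
      symm
      refine Finset.sum_bij_ne_zero (fun y _ _ => B.transpose.mulVec y) (by simp) ?_ ?_ ?_
      · intro a _ ha b _ hb hab
        rw [← hD a (hψ0 a (right_ne_zero_of_mul ha)), ← hD b (hψ0 b (right_ne_zero_of_mul hb)), hab]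
      · intro s _ hs
        have h2 := right_ne_zero_of_mul hs
        simp only [uncompute, addSyndrome, zero_add] at h2
        split_ifs at h2 with h3
        · refine ⟨D s, Finset.mem_univ _, ?_, h3.symm⟩
          rw [← h3]
          exact mul_ne_zero (left_ne_zero_of_mul hs) h2
        · exact absurd rfl h2
      · intro y _ hy
        have := hD y (hψ0 y (right_ne_zero_of_mul hy))
        simp [uncompute, addSyndrome, this]
    have hval : ∑ y : Fin m → ZMod 2, (sgn (x ⬝ᵥ B.transpose.mulVec y) : ℂ) * ψ y =
        ((P.eval (excess B v x) : ℝ) : ℂ) := by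
      have hs : ∀ y : Fin m → ZMod 2, (sgn (x ⬝ᵥ B.transpose.mulVec y) : ℂ) * ψ y =
          ∑ j ∈ Finset.range (ℓ + 1), if hammingNorm y = j then
            ((w j * (1 / Real.sqrt (m.choose j)) * sgn ((B.mulVec x + v) ⬝ᵥ y) : ℝ) : ℂ)
            else 0 := by
        intro y
        have e : x ⬝ᵥ B.transpose.mulVec y = B.mulVec x ⬝ᵥ y := by
          rw [Matrix.mulVec_transpose, dotProduct_comm, ← Matrix.dotProduct_mulVec,
            dotProduct_comm]
        rw [hψ, phase, resource, e, add_dotProduct, sgn_add, Finset.mul_sum, Finset.mul_sum]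
        refine Finset.sum_congr rfl fun j _ => ?_
        unfold dicke
        split_ifs
        · push_cast; ring
        · simp
      rw [Finset.sum_congr rfl fun y _ => hs y, Finset.sum_comm, excess_eq, hP]
      push_cast
      refine Finset.sum_congr rfl fun j _ => ?_
      rw [Finset.mul_sum, Finset.sum_filter]
    rw [finalState, hadamard, ← hψ]
    simp only
    rw [hsum, hval]
    push_cast
    rfl
  rw [outputProb, Finset.sum_eq_single 0 (fun u _ hu => by simp [hU u hu]) (by simp), h0,
    Complex.norm_real, Real.norm_eq_abs, sq_abs, mul_pow, div_pow,
    Real.sq_sqrt (by positivity)]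
  ring

/-- The probability, over the transposed Gallager ensemble (`B = Hᵀ` with `H ∼ 𝒢(d N, k, d)` and
`v` uniform, independent) and over the measurement, that `DQI_ℓ` outputs a bit string whose
satisfied fraction `g / m` exceeds `μ`. -/
def successProb (k d N ℓ : ℕ) (w : ℕ → ℝ)
    (D : Matrix (Fin k × Fin N) (Fin (d * N)) (ZMod 2) →
      (Fin k × Fin N → ZMod 2) → (Fin (d * N) → ZMod 2)) (μ : ℝ) : ℝ :=
  open scoped Classical in
  𝔼 G : Layers k d N, 𝔼 v : Fin (d * N) → ZMod 2,
    ∑ x : Fin k × Fin N → ZMod 2 with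
        μ < numSat (parityCheck G).transpose v x / ((d * N : ℕ) : ℝ),
      outputProb ℓ w (D (parityCheck G)) (parityCheck G).transpose v x

end DQI

end

namespace DQI

/-! ### Fourier analysis on the Boolean cube -/

section Fourier

/-! The obstruction comes from the random parities alone: the estimate holds for every fixed matrix
`B` and every decoder, so no property of the Gallager code enters.

Split the resource state according to the residual error `u` left by the decoder. The piece for each
`u` is a function on the cube supported on weights at most `ℓ`, and its output amplitude at `x` is
its Walsh transform at `r = B x + v` (`finalState_eq`). For uniform `v`, each `x` sees a uniform
`r`, so the second moment of the excess is an average of `(m - 2|r|)²` against squared Walsh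
coefficients. The factor `m - 2|r|` is the eigenvalue of the adjacency operator of the cube
(`walsh_cubeAdj`). By Parseval, the moment is governed by the norm of this operator on a Hamming
ball of radius `ℓ`, which is at most `2√((ℓ+1)m)` (`sum_cubeAdj_sq_le`). Chebyshev's inequality then
bounds the success probability by `(ℓ+1)/((μ-1/2)² m)` (`successProb_le`).

It remains to compare scales. Since `H₂⁻¹(y) ≤ y`, the ratio `ℓ/m` is `O(c/(kλ))`, whereas the
expansion of `H₂` at `1/2` makes `(μ-1/2)²` of order `c ln k/(kλ)`. The factor `ln k` wins for large
`k`. For the remaining finitely many `k`, the freedom in `ε₂` allows `μ = 1`, which no output can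
exceed. -/

theorem sgn_zero : sgn 0 = 1 := by simp [sgn_eq]

theorem sgn_one : sgn 1 = -1 := by simp [sgn_eq]

theorem zmod_two_eq_one {a : ZMod 2} (h : a ≠ 0) : a = 1 := by
  revert a; decide

theorem cube_add_self {ι : Type*} (y : ι → ZMod 2) : y + y = 0 := by
  funext i
  exact CharTwo.add_self_eq_zero (y i)

theorem cube_add_add_cancel {ι : Type*} (y z : ι → ZMod 2) : y + z + z = y := by
  rw [add_assoc, cube_add_self, add_zero]

theorem cube_add_eq_zero_iff {ι : Type*} (y z : ι → ZMod 2) : y + z = 0 ↔ y = z := by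
  constructor
  · intro h
    rw [← cube_add_add_cancel y z, h, zero_add]
  · rintro rfl
    exact cube_add_self y

theorem sum_sgn_eq {ι : Type*} [Fintype ι] (r : ι → ZMod 2) :
    ∑ i, sgn (r i) = (Fintype.card ι : ℝ) - 2 * hammingNorm r := by
  have key : ∀ a : ZMod 2, sgn a = 1 - 2 * (if a ≠ 0 then (1 : ℝ) else 0) := by
    intro a
    rw [sgn_eq]
    by_cases ha : a = 0 <;> simp [ha]
    norm_num
  simp only [key, Finset.sum_sub_distrib, ← Finset.mul_sum, hammingNorm, Finset.sum_boole]
  simp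

theorem hammingNorm_eq_sum {ι : Type*} [Fintype ι] (y : ι → ZMod 2) :
    (hammingNorm y : ℝ) = ∑ i, if y i ≠ 0 then (1 : ℝ) else 0 := by
  rw [Finset.sum_boole, hammingNorm]

variable {ι : Type*} [Fintype ι] [DecidableEq ι]

/-- The (unnormalized) Walsh–Hadamard transform of a function on the Boolean cube. -/
noncomputable def walsh (f : (ι → ZMod 2) → ℝ) (r : ι → ZMod 2) : ℝ :=
  ∑ y, sgn (r ⬝ᵥ y) * f y

/-- The adjacency operator of the Boolean cube. -/
def cubeAdj (f : (ι → ZMod 2) → ℝ) (y : ι → ZMod 2) : ℝ :=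
  ∑ i, f (y + Pi.single i 1)

theorem sum_sgn_dotProduct (z : ι → ZMod 2) :
    ∑ r : ι → ZMod 2, sgn (r ⬝ᵥ z) = if z = 0 then 2 ^ Fintype.card ι else 0 := by
  split_ifs with hz
  · subst hz
    simp [sgn_zero, ZMod.card]
  · obtain ⟨i, hi⟩ := Function.ne_iff.mp hz
    have hi1 : z i = 1 := zmod_two_eq_one hi
    -- Flipping coordinate `i` of `r` reverses every sign, because `z i = 1`.
    have h : ∑ r : ι → ZMod 2, sgn (r ⬝ᵥ z) = -∑ r : ι → ZMod 2, sgn (r ⬝ᵥ z) := by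
      conv_lhs => rw [← Equiv.sum_comp (Equiv.addRight (Pi.single i (1 : ZMod 2)))]
      rw [← Finset.sum_neg_distrib]
      refine Finset.sum_congr rfl fun r _ => ?_
      simp [add_dotProduct, sgn_add, hi1, sgn_one]
    linarith

/-- Parseval's identity. -/
theorem sum_walsh_sq (f : (ι → ZMod 2) → ℝ) :
    ∑ r, walsh f r ^ 2 = 2 ^ Fintype.card ι * ∑ y, f y ^ 2 := by
  have h : ∀ r, walsh f r ^ 2 = ∑ y, ∑ z, f y * f z * sgn (r ⬝ᵥ (y + z)) := by
    intro r
    rw [sq, walsh, Finset.sum_mul_sum]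
    refine Finset.sum_congr rfl fun y _ => Finset.sum_congr rfl fun z _ => ?_
    rw [dotProduct_add, sgn_add]
    ring
  simp only [h]
  rw [Finset.sum_comm, Finset.mul_sum]
  refine Finset.sum_congr rfl fun y _ => ?_
  rw [Finset.sum_comm]
  simp only [← Finset.mul_sum, sum_sgn_dotProduct, cube_add_eq_zero_iff]
  simp
  ring

/-- The Walsh–Hadamard transform diagonalizes the adjacency operator. -/
theorem walsh_cubeAdj (f : (ι → ZMod 2) → ℝ) (r : ι → ZMod 2) :
    walsh (cubeAdj f) r = ((Fintype.card ι : ℝ) - 2 * hammingNorm r) * walsh f r := by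
  rw [← sum_sgn_eq, walsh, Finset.sum_mul]
  simp only [cubeAdj, Finset.mul_sum]
  rw [Finset.sum_comm]
  refine Finset.sum_congr rfl fun i _ => ?_
  rw [← Equiv.sum_comp (Equiv.addRight (Pi.single i (1 : ZMod 2))), walsh, Finset.mul_sum]
  refine Finset.sum_congr rfl fun y _ => ?_
  simp only [Equiv.coe_addRight, cube_add_add_cancel, dotProduct_add, sgn_add,
    dotProduct_single, mul_one]
  ring

theorem hammingNorm_le_succ (y : ι → ZMod 2) (i : ι) :
    hammingNorm y ≤ hammingNorm (y + Pi.single i (1 : ZMod 2)) + 1 := by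
  have h := hammingDist_triangle y (y + Pi.single i (1 : ZMod 2)) 0
  rw [hammingDist_zero_right, hammingDist_zero_right, add_comm] at h
  refine h.trans (Nat.add_le_add_left ?_ _)
  rw [hammingDist]
  refine (Finset.card_le_card (t := {i}) fun j hj => ?_).trans (Finset.card_singleton i).le
  by_contra hji
  rw [Finset.mem_singleton] at hji
  simp [Pi.single_eq_of_ne hji] at hj

/-- On functions supported in a Hamming ball of radius `l`, the adjacency operator of the cube has
norm at most `2 √((l + 1) m)`. -/
theorem sum_cubeAdj_sq_le {l : ℕ} {f : (ι → ZMod 2) → ℝ}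
    (hf : ∀ y, f y ≠ 0 → hammingNorm y ≤ l) :
    ∑ y, cubeAdj f y ^ 2 ≤ 4 * (l + 1) * Fintype.card ι * ∑ y, f y ^ 2 := by
  set m : ℝ := ((Fintype.card ι : ℕ) : ℝ) with hm
  have hm0 : 0 ≤ m := Nat.cast_nonneg _
  set F : (ι → ZMod 2) → ι → ℝ := fun y i => f (y + Pi.single i 1) with hF
  -- Separate the neighbours of `y` that are heavier (`y i = 0`) from the lighter ones (`y i ≠ 0`),
  -- and apply Cauchy–Schwarz to each group. There are at most `m` heavier neighbours and exactly
  -- `|y|` lighter ones. The factors 2 come from `(a + b)² ≤ 2a² + 2b²`.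
  have hpt : ∀ y, cubeAdj f y ^ 2 ≤
      2 * (m * ∑ i, (if y i ≠ 0 then 0 else F y i ^ 2)) +
      2 * ((l + 1) * ∑ i, (if y i ≠ 0 then F y i ^ 2 else 0)) := by
    intro y
    set a := ∑ i, if y i ≠ 0 then 0 else F y i with ha
    set b := ∑ i, if y i ≠ 0 then F y i else 0 with hb
    have hab : cubeAdj f y = a + b := by
      rw [cubeAdj, ha, hb, ← Finset.sum_add_distrib]
      refine Finset.sum_congr rfl fun i _ => ?_
      by_cases h : y i = 0 <;> simp [h, hF]
    have ha2 : a ^ 2 ≤ m * ∑ i, (if y i ≠ 0 then 0 else F y i ^ 2) := by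
      refine (sq_sum_le_card_mul_sum_sq).trans (le_of_eq ?_)
      rw [Finset.card_univ]
      congr 1
      refine Finset.sum_congr rfl fun i _ => ?_
      split_ifs <;> simp
    have hb2 : b ^ 2 ≤ (l + 1) * ∑ i, (if y i ≠ 0 then F y i ^ 2 else 0) := by
      by_cases hy : hammingNorm y ≤ l + 1
      · have h1 : b = ∑ i with y i ≠ 0, F y i := by rw [hb, Finset.sum_filter]
        rw [h1, ← Finset.sum_filter]
        refine (sq_sum_le_card_mul_sum_sq).trans ?_
        refine mul_le_mul_of_nonneg_right ?_ (Finset.sum_nonneg fun i _ => sq_nonneg _)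
        exact_mod_cast hy
      -- If `|y| > l + 1`, every neighbour of `y` still lies outside the ball.
      · have h0 : b = 0 := by
          refine Finset.sum_eq_zero fun i _ => ?_
          have : F y i = 0 := by
            by_contra h
            have := hf _ h
            have := hammingNorm_le_succ y i
            omega
          simp [this]
        rw [h0, zero_pow two_ne_zero]
        have : 0 ≤ ∑ i, (if y i ≠ 0 then F y i ^ 2 else 0) :=
          Finset.sum_nonneg fun i _ => by split_ifs <;> positivity
        exact mul_nonneg (by positivity) this
    rw [hab]
    nlinarith [sq_nonneg (a - b)]
  -- Double counting over edges: exchanging the endpoints turns the sums into counts of how often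
  -- each `f y ^ 2` occurs. This is at most `l` times as a heavier neighbour and at most `m` times
  -- as a lighter one.
  have hswap : ∀ (g : ι → (ι → ZMod 2) → ℝ), ∑ y, ∑ i, g i y =
      ∑ y : ι → ZMod 2, ∑ i, g i (y + Pi.single i 1) := by
    intro g
    rw [Finset.sum_comm]
    refine Eq.trans (Finset.sum_congr rfl fun i _ => ?_) Finset.sum_comm
    rw [← Equiv.sum_comp (Equiv.addRight (Pi.single i (1 : ZMod 2)))]
    rfl
  have hup : ∑ y : ι → ZMod 2, ∑ i, (if y i ≠ 0 then 0 else F y i ^ 2) ≤ l * ∑ y, f y ^ 2 := by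
    rw [hswap (fun i y => if y i ≠ 0 then 0 else F y i ^ 2), Finset.mul_sum]
    refine Finset.sum_le_sum fun y _ => ?_
    have h1 : ∀ i, (if (y + Pi.single i 1 : ι → ZMod 2) i ≠ 0 then 0 else
        F (y + Pi.single i 1) i ^ 2)
        = (if y i ≠ 0 then 1 else 0) * f y ^ 2 := by
      intro i
      have e : F (y + Pi.single i 1) i = f y := by simp [hF, cube_add_add_cancel]
      rw [e]
      by_cases h : y i = 0
      · simp [h]
      · simp [zmod_two_eq_one h, CharTwo.add_self_eq_zero]
    simp only [h1]
    rw [← Finset.sum_mul, ← hammingNorm_eq_sum]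
    by_cases hy : f y = 0
    · simp [hy]
    · exact mul_le_mul_of_nonneg_right (by exact_mod_cast hf y hy) (sq_nonneg _)
  have hdown : ∑ y : ι → ZMod 2, ∑ i, (if y i ≠ 0 then F y i ^ 2 else 0) ≤ m * ∑ y, f y ^ 2 := by
    rw [hswap (fun i y => if y i ≠ 0 then F y i ^ 2 else 0), Finset.mul_sum]
    refine Finset.sum_le_sum fun y _ => ?_
    refine (Finset.sum_le_card_nsmul Finset.univ _ (f y ^ 2) fun i _ => ?_).trans (le_of_eq ?_)
    · have e : F (y + Pi.single i 1) i = f y := by simp [hF, cube_add_add_cancel]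
      simp only [e]
      split_ifs
      · exact le_rfl
      · positivity
    · rw [nsmul_eq_mul, Finset.card_univ]
  have hS : 0 ≤ ∑ y, f y ^ 2 := Finset.sum_nonneg fun y _ => sq_nonneg _
  calc ∑ y, cubeAdj f y ^ 2
      ≤ ∑ y : ι → ZMod 2, (2 * (m * ∑ i, (if y i ≠ 0 then 0 else F y i ^ 2)) +
          2 * ((l + 1) * ∑ i, (if y i ≠ 0 then F y i ^ 2 else 0))) :=
        Finset.sum_le_sum fun y _ => hpt y
    _ = 2 * (m * ∑ y : ι → ZMod 2, ∑ i, (if y i ≠ 0 then 0 else F y i ^ 2)) +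
          2 * ((l + 1) * ∑ y : ι → ZMod 2, ∑ i, (if y i ≠ 0 then F y i ^ 2 else 0)) := by
        rw [Finset.sum_add_distrib]
        simp only [← Finset.mul_sum]
    _ ≤ 2 * (m * (l * ∑ y, f y ^ 2)) + 2 * ((l + 1) * (m * ∑ y, f y ^ 2)) := by
        gcongr
    _ ≤ 4 * (l + 1) * m * ∑ y, f y ^ 2 := by nlinarith [mul_nonneg hm0 hS]

/-- Parseval applied to `cubeAdj f`, whose Walsh coefficients are those of `f` times the
eigenvalues. -/
theorem sum_sq_mul_walsh_sq_le {l : ℕ} {f : (ι → ZMod 2) → ℝ}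
    (hf : ∀ y, f y ≠ 0 → hammingNorm y ≤ l) :
    ∑ r, ((Fintype.card ι : ℝ) - 2 * hammingNorm r) ^ 2 * walsh f r ^ 2 ≤
      2 ^ Fintype.card ι * (4 * (l + 1) * Fintype.card ι * ∑ y, f y ^ 2) := by
  simp only [← mul_pow, ← walsh_cubeAdj]
  rw [sum_walsh_sq]
  exact mul_le_mul_of_nonneg_left (sum_cubeAdj_sq_le hf) (by positivity)

end Fourier

/-! ### The output distribution of DQI -/

/-- The real amplitudes of the resource state. -/
noncomputable def resourceAmp (m ℓ : ℕ) (w : ℕ → ℝ) (y : Fin m → ZMod 2) : ℝ :=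
  ∑ j ∈ Finset.range (ℓ + 1), w j * if hammingNorm y = j then 1 / Real.sqrt (m.choose j) else 0

theorem resource_eq_ofReal (m ℓ : ℕ) (w : ℕ → ℝ) (y : Fin m → ZMod 2) :
    resource m ℓ w y = (resourceAmp m ℓ w y : ℂ) := by
  rw [resource, resourceAmp]
  push_cast
  refine Finset.sum_congr rfl fun j _ => ?_
  rw [dicke]
  split_ifs <;> simp

theorem resourceAmp_of_le {m ℓ : ℕ} {w : ℕ → ℝ} {y : Fin m → ZMod 2} (hy : hammingNorm y ≤ ℓ) :
    resourceAmp m ℓ w y = w (hammingNorm y) * (1 / Real.sqrt (m.choose (hammingNorm y))) := by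
  rw [resourceAmp, Finset.sum_eq_single (hammingNorm y)]
  · simp
  · intro j _ hj
    simp [hj.symm]
  · intro h
    exact absurd (Finset.mem_range.mpr (Nat.lt_succ_of_le hy)) h

theorem resourceAmp_of_lt {m ℓ : ℕ} {w : ℕ → ℝ} {y : Fin m → ZMod 2} (hy : ℓ < hammingNorm y) :
    resourceAmp m ℓ w y = 0 := by
  have h := resource_eq_zero (w := w) (not_le.mpr hy)
  rwa [resource_eq_ofReal, Complex.ofReal_eq_zero] at h

theorem card_hammingNorm_eq (m j : ℕ) :
    (Finset.univ.filter fun y : Fin m → ZMod 2 => hammingNorm y = j).card = m.choose j := by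
  have h : (Finset.powersetCard j (Finset.univ : Finset (Fin m))).card = m.choose j := by
    simp
  rw [← h]
  refine Finset.card_bij' (fun y _ => Finset.univ.filter fun i => y i ≠ 0)
    (fun s _ i => if i ∈ s then 1 else 0) ?_ ?_ ?_ ?_
  · intro y hy
    simpa [Finset.mem_powersetCard, hammingNorm] using hy
  · intro s hs
    simpa [Finset.mem_powersetCard, hammingNorm] using hs
  · intro y _
    funext i
    by_cases hi : y i = 0
    · simp [hi]
    · simp [zmod_two_eq_one hi]
  · intro s _
    ext i
    simp

/-- The resource state has the norm of the weight vector. -/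
theorem sum_resourceAmp_sq {m ℓ : ℕ} (hℓ : ℓ ≤ m) (w : ℕ → ℝ) :
    ∑ y, resourceAmp m ℓ w y ^ 2 = ∑ j ∈ Finset.range (ℓ + 1), w j ^ 2 := by
  have h : ∀ y, resourceAmp m ℓ w y ^ 2 = ∑ j ∈ Finset.range (ℓ + 1),
      if hammingNorm y = j then w j ^ 2 / m.choose j else 0 := by
    intro y
    by_cases hy : hammingNorm y ≤ ℓ
    · rw [resourceAmp_of_le hy, Finset.sum_eq_single (hammingNorm y)]
      · rw [mul_pow, div_pow, Real.sq_sqrt (Nat.cast_nonneg _)]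
        simp [div_eq_mul_inv]
      · intro j _ hj
        simp [hj.symm]
      · intro h
        exact absurd (Finset.mem_range.mpr (Nat.lt_succ_of_le hy)) h
    · rw [resourceAmp_of_lt (not_le.mp hy), Finset.sum_eq_zero]
      · simp
      · intro j hj
        have := Finset.mem_range.mp hj
        rw [if_neg (by omega)]
  simp only [h]
  rw [Finset.sum_comm]
  refine Finset.sum_congr rfl fun j hj => ?_
  have hjm : j ≤ m := (Nat.lt_succ_iff.mp (Finset.mem_range.mp hj)).trans hℓ
  have hc : (m.choose j : ℝ) ≠ 0 := by exact_mod_cast (Nat.choose_pos hjm).ne'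
  rw [← Finset.sum_filter, Finset.sum_const, card_hammingNorm_eq, nsmul_eq_mul]
  field_simp

section Output

variable {m : ℕ} {V : Type*}

/-- The part of the resource state on which the decoder leaves the residual error `u`. -/
noncomputable def residualAmp (ℓ : ℕ) (w : ℕ → ℝ) (D : (V → ZMod 2) → (Fin m → ZMod 2))
    (B : Matrix (Fin m) V (ZMod 2)) (u y : Fin m → ZMod 2) : ℝ :=
  if y + D (B.transpose.mulVec y) = u then resourceAmp m ℓ w y else 0

/-- Each error `y` leaves exactly one residual `u`, so the pieces have disjoint supports and no norm
is lost even when decoding fails. -/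
theorem sum_residualAmp_sq (ℓ : ℕ) (w : ℕ → ℝ) (D : (V → ZMod 2) → (Fin m → ZMod 2))
    (B : Matrix (Fin m) V (ZMod 2)) :
    ∑ u, ∑ y, residualAmp ℓ w D B u y ^ 2 = ∑ y, resourceAmp m ℓ w y ^ 2 := by
  rw [Finset.sum_comm]
  refine Finset.sum_congr rfl fun y _ => ?_
  rw [Finset.sum_eq_single (y + D (B.transpose.mulVec y))]
  · simp [residualAmp]
  · intro u _ hu
    simp [residualAmp, hu.symm]
  · simp

variable [Fintype V] [DecidableEq V]

/-- The amplitudes of the final state depend on the output `x` and the parities `v` only through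
`B x + v`. -/
theorem finalState_eq (ℓ : ℕ) (w : ℕ → ℝ) (D : (V → ZMod 2) → (Fin m → ZMod 2))
    (B : Matrix (Fin m) V (ZMod 2)) (v u : Fin m → ZMod 2) (x : V → ZMod 2) :
    finalState ℓ w D B v (u, x) =
      ((1 / Real.sqrt (2 ^ Fintype.card V) *
        walsh (residualAmp ℓ w D B u) (B.mulVec x + v) : ℝ) : ℂ) := by
  have hsum : ∑ s : V → ZMod 2, (sgn (x ⬝ᵥ s) : ℂ) *
        uncompute D (addSyndrome B (phase v (resource m ℓ w))) (u, s) =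
      ∑ y : Fin m → ZMod 2, ((sgn ((B.mulVec x + v) ⬝ᵥ y) * residualAmp ℓ w D B u y : ℝ) : ℂ) := by
    have h1 : ∀ s : V → ZMod 2, (sgn (x ⬝ᵥ s) : ℂ) *
        uncompute D (addSyndrome B (phase v (resource m ℓ w))) (u, s) =
        ∑ y : Fin m → ZMod 2, if y = u + D s then (if s = B.transpose.mulVec y then
          (sgn (x ⬝ᵥ s) : ℂ) * phase v (resource m ℓ w) y else 0) else 0 := by
      intro s
      rw [Finset.sum_ite_eq' Finset.univ]
      simp [uncompute, addSyndrome]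
    have h2 : ∀ y : Fin m → ZMod 2,
        ((sgn ((B.mulVec x + v) ⬝ᵥ y) * residualAmp ℓ w D B u y : ℝ) : ℂ) =
        ∑ s : V → ZMod 2, if s = B.transpose.mulVec y then (if y = u + D s then
          (sgn (x ⬝ᵥ s) : ℂ) * phase v (resource m ℓ w) y else 0) else 0 := by
      intro y
      have e : x ⬝ᵥ B.transpose.mulVec y = B.mulVec x ⬝ᵥ y := by
        rw [Matrix.mulVec_transpose, dotProduct_comm, ← Matrix.dotProduct_mulVec,
          dotProduct_comm]
      have hiff : y + D (B.transpose.mulVec y) = u ↔ y = u + D (B.transpose.mulVec y) := by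
        constructor
        · intro h
          rw [← h, cube_add_add_cancel]
        · intro h
          conv_lhs => rw [h]
          have h3 : u + D (B.transpose.mulVec y) = y := h.symm
          rw [h3]
          nth_rewrite 1 [h]
          rw [cube_add_add_cancel]
      rw [Finset.sum_ite_eq' Finset.univ, residualAmp, e, add_dotProduct, sgn_add, phase,
        resource_eq_ofReal]
      simp only [hiff, Finset.mem_univ, if_true]
      split_ifs
      · push_cast; ring
      · simp
    simp only [h1, h2]
    rw [Finset.sum_comm]
    refine Finset.sum_congr rfl fun y _ => Finset.sum_congr rfl fun s _ => ?_
    split_ifs <;> rfl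
  rw [finalState, hadamard]
  simp only
  rw [hsum, walsh]
  push_cast
  rfl

theorem outputProb_eq (ℓ : ℕ) (w : ℕ → ℝ) (D : (V → ZMod 2) → (Fin m → ZMod 2))
    (B : Matrix (Fin m) V (ZMod 2)) (v : Fin m → ZMod 2) (x : V → ZMod 2) :
    outputProb ℓ w D B v x = (2 ^ Fintype.card V : ℝ)⁻¹ *
      ∑ u, walsh (residualAmp ℓ w D B u) (B.mulVec x + v) ^ 2 := by
  rw [outputProb, Finset.mul_sum]
  refine Finset.sum_congr rfl fun u _ => ?_
  rw [finalState_eq, Complex.norm_real, Real.norm_eq_abs, sq_abs, mul_pow, div_pow,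
    Real.sq_sqrt (by positivity), one_pow, one_div]

/-- For uniformly random parities, the second moment of the excess of the output of DQI is at most
`4 (ℓ + 1) m`, whatever the decoder does. -/
theorem expect_sum_excess_sq_mul_outputProb_le {ℓ : ℕ} (hℓ : ℓ ≤ m) {w : ℕ → ℝ}
    (hw : ∑ j ∈ Finset.range (ℓ + 1), w j ^ 2 = 1) (D : (V → ZMod 2) → (Fin m → ZMod 2))
    (B : Matrix (Fin m) V (ZMod 2)) :
    𝔼 v : Fin m → ZMod 2, ∑ x, excess B v x ^ 2 * outputProb ℓ w D B v x ≤ 4 * (ℓ + 1) * m := by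
  set Q : (Fin m → ZMod 2) → ℝ := fun r =>
    ((m : ℝ) - 2 * hammingNorm r) ^ 2 * ∑ u, walsh (residualAmp ℓ w D B u) r ^ 2 with hQ
  have h1 : ∀ v x, excess B v x ^ 2 * outputProb ℓ w D B v x =
      (2 ^ Fintype.card V : ℝ)⁻¹ * Q (B.mulVec x + v) := by
    intro v x
    rw [outputProb_eq, excess, hQ]
    ring
  have h2 : ∑ r, Q r ≤ 2 ^ m * (4 * (ℓ + 1) * m) := by
    have h3 : ∀ u, ∑ r, ((m : ℝ) - 2 * hammingNorm r) ^ 2 * walsh (residualAmp ℓ w D B u) r ^ 2 ≤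
        2 ^ m * (4 * (ℓ + 1) * m * ∑ y, residualAmp ℓ w D B u y ^ 2) := by
      intro u
      have h := sum_sq_mul_walsh_sq_le (l := ℓ) (f := residualAmp ℓ w D B u) fun y hy => by
        by_contra hlt
        exact hy (by simp [residualAmp, resourceAmp_of_lt (not_le.mp hlt)])
      rwa [Fintype.card_fin] at h
    simp only [hQ, Finset.mul_sum]
    rw [Finset.sum_comm]
    refine (Finset.sum_le_sum fun u _ => h3 u).trans (le_of_eq ?_)
    rw [← Finset.mul_sum, ← Finset.mul_sum, sum_residualAmp_sq, sum_resourceAmp_sq hℓ, hw]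
    ring
  have hV : Fintype.card (V → ZMod 2) = 2 ^ Fintype.card V := by simp [ZMod.card]
  have hm : Fintype.card (Fin m → ZMod 2) = 2 ^ m := by simp [ZMod.card]
  simp only [h1]
  rw [Fintype.expect_eq_sum_div_card, hm, Finset.sum_comm, div_le_iff₀ (by positivity)]
  -- Translation by `B x` permutes the parities, so every `x` contributes the same total; the `2 ^
  -- |V|` outputs then cancel the Hadamard normalization.
  have h4 : ∀ x : V → ZMod 2, ∑ v, (2 ^ Fintype.card V : ℝ)⁻¹ * Q (B.mulVec x + v) =
      (2 ^ Fintype.card V : ℝ)⁻¹ * ∑ r, Q r := by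
    intro x
    rw [← Finset.mul_sum]
    congr 1
    exact Equiv.sum_comp (Equiv.addLeft (B.mulVec x)) Q
  simp only [h4]
  rw [Finset.sum_const, Finset.card_univ, hV, nsmul_eq_mul, ← mul_assoc]
  push_cast
  rw [mul_inv_cancel₀ (by positivity), one_mul]
  linarith

open scoped Classical in
/-- Whatever the decoder, DQI rarely satisfies many more than `m / 2 + √(ℓ m)` clauses when the
parities are uniformly random. -/
theorem expect_sum_outputProb_le {ℓ : ℕ} (hℓ : ℓ ≤ m) (hm : 0 < m) {w : ℕ → ℝ}
    (hw : ∑ j ∈ Finset.range (ℓ + 1), w j ^ 2 = 1) (D : (V → ZMod 2) → (Fin m → ZMod 2))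
    (B : Matrix (Fin m) V (ZMod 2)) {μ : ℝ} (hμ : 1 / 2 < μ) :
    𝔼 v : Fin m → ZMod 2, ∑ x with μ < numSat B v x / m, outputProb ℓ w D B v x ≤
      (ℓ + 1) / ((μ - 1 / 2) ^ 2 * m) := by
  have hm' : (0 : ℝ) < m := Nat.cast_pos.mpr hm
  -- As `f = 2g - m`, the event `g > μ m` forces the excess above `2(μ - 1/2)m`; Chebyshev's
  -- inequality is applied at this threshold.
  set t : ℝ := 2 * (μ - 1 / 2) * m with ht
  have ht0 : 0 < t := by
    have : 0 < μ - 1 / 2 := by linarith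
    positivity
  have hp : ∀ v x, 0 ≤ outputProb ℓ w D B v x := fun v x =>
    Finset.sum_nonneg fun u _ => sq_nonneg _
  have h1 : ∀ v, ∑ x with μ < numSat B v x / m, outputProb ℓ w D B v x ≤
      ∑ x, (t ^ 2)⁻¹ * (excess B v x ^ 2 * outputProb ℓ w D B v x) := by
    intro v
    rw [Finset.sum_filter]
    refine Finset.sum_le_sum fun x _ => ?_
    split_ifs with h
    · rw [lt_div_iff₀ hm'] at h
      have h2 : t ≤ excess B v x := by
        rw [numSat] at h
        rw [excess, ht]
        linarith
      rw [← mul_assoc, inv_mul_eq_div]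
      refine le_mul_of_one_le_left (hp v x) ?_
      rw [one_le_div (by positivity)]
      exact pow_le_pow_left₀ ht0.le h2 2
    · have := hp v x
      positivity
  refine (Finset.expect_le_expect fun v _ => h1 v).trans ?_
  simp only [← Finset.mul_sum]
  rw [← Finset.mul_expect]
  refine (mul_le_mul_of_nonneg_left (expect_sum_excess_sq_mul_outputProb_le hℓ hw D B)
    (by positivity)).trans (le_of_eq ?_)
  have hμ0 : μ - 1 / 2 ≠ 0 := by linarith
  rw [ht]
  field_simp
  ring

end Output

theorem successProb_le {k d N ℓ : ℕ} (hℓ : ℓ ≤ d * N) (hm : 0 < d * N) {w : ℕ → ℝ}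
    (hw : ∑ j ∈ Finset.range (ℓ + 1), w j ^ 2 = 1)
    (D : Matrix (Fin k × Fin N) (Fin (d * N)) (ZMod 2) →
      (Fin k × Fin N → ZMod 2) → (Fin (d * N) → ZMod 2)) {μ : ℝ} (hμ : 1 / 2 < μ) :
    successProb k d N ℓ w D μ ≤ (ℓ + 1) / ((μ - 1 / 2) ^ 2 * ((d * N : ℕ) : ℝ)) :=
  Finset.expect_le Finset.univ_nonempty fun G _ =>
    expect_sum_outputProb_le hℓ hm hw (D (parityCheck G)) (parityCheck G).transpose hμ

/-- A satisfied fraction never exceeds 1; this settles the small values of `k`. -/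
theorem successProb_eq_zero {k d N ℓ : ℕ} {w : ℕ → ℝ}
    (D : Matrix (Fin k × Fin N) (Fin (d * N)) (ZMod 2) →
      (Fin k × Fin N → ZMod 2) → (Fin (d * N) → ZMod 2)) {μ : ℝ} (hμ : 1 ≤ μ) :
    successProb k d N ℓ w D μ = 0 := by
  refine Finset.expect_eq_zero fun G _ => Finset.expect_eq_zero fun v _ => ?_
  refine Finset.sum_eq_zero fun x hx => ?_
  exfalso
  have h := (Finset.mem_filter.mp hx).2
  have h1 : numSat (parityCheck G).transpose v x / ((d * N : ℕ) : ℝ) ≤ 1 := by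
    refine div_le_one_of_le₀ ?_ (Nat.cast_nonneg _)
    rw [numSat]
    exact sub_le_self _ (Nat.cast_nonneg _)
  linarith

/-! ### Asymptotics of the binary entropy -/

theorem H₂_strictMonoOn : StrictMonoOn H₂ (Set.Icc 0 (1 / 2)) := by
  intro x hx y hy hxy
  have h := Real.binEntropy_strictMonoOn (by simpa using hx) (by simpa using hy) hxy
  exact div_lt_div_of_pos_right h (Real.log_pos one_lt_two)

theorem H₂inv_zero : H₂inv 0 = 0 := by
  obtain ⟨h1, h2⟩ := H₂inv_spec (y := 0) (by simp)
  refine H₂_strictMonoOn.injOn h1 (by norm_num) ?_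
  rw [h2]
  simp [H₂]

/-- By concavity, the entropy lies above its chord from `0` to `1/2`, which has slope 2 in bits;
slope 1 is all that is needed. -/
theorem le_H₂ {x : ℝ} (hx : x ∈ Set.Icc (0 : ℝ) (1 / 2)) : x ≤ H₂ x := by
  have hl := Real.log_pos one_lt_two
  rw [H₂, le_div_iff₀ hl]
  have hconc := Real.strictConcave_binEntropy.concaveOn.2
  have h := hconc (by norm_num : (0 : ℝ) ∈ Set.Icc (0 : ℝ) 1)
    (by norm_num : (2⁻¹ : ℝ) ∈ Set.Icc (0 : ℝ) 1)
    (by linarith [hx.2] : 0 ≤ 1 - 2 * x) (by linarith [hx.1] : 0 ≤ 2 * x) (by ring)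
  simp only [smul_eq_mul, mul_zero, Real.binEntropy_zero, Real.binEntropy_two_inv, zero_add] at h
  have e : 2 * x * 2⁻¹ = x := by ring
  rw [e] at h
  nlinarith [mul_nonneg hx.1 hl.le]

theorem H₂inv_le {y : ℝ} (hy : y ∈ Set.Icc (0 : ℝ) 1) : H₂inv y ≤ y := by
  obtain ⟨h1, h2⟩ := H₂inv_spec hy
  exact (le_H₂ h1).trans h2.le

/-- The second-order expansion of the binary entropy at `1 / 2`. -/
theorem abs_log_two_sub_binEntropy_sub_le {a : ℝ} (h0 : 0 ≤ a) (h1 : a ≤ 1 / 4) :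
    |Real.log 2 - Real.binEntropy (1 / 2 - a) - 2 * a ^ 2| ≤ 16 * a ^ 3 := by
  have hlog : ∀ x : ℝ, |x| ≤ 1 / 2 → |x + x ^ 2 / 2 + Real.log (1 - x)| ≤ 2 * |x| ^ 3 := by
    intro x hx
    have h := Real.abs_log_sub_add_sum_range_le (x := x) (by linarith) 2
    have h2 : |x| ^ 3 / (1 - |x|) ≤ 2 * |x| ^ 3 := by
      rw [div_le_iff₀ (by linarith)]
      nlinarith [pow_nonneg (abs_nonneg x) 3]
    refine le_trans (le_of_eq ?_) (h.trans h2)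
    congr 1
    simp [Finset.sum_range_succ]
    norm_num
  have hx : |2 * a| = 2 * a := abs_of_nonneg (by linarith)
  have hp := hlog (2 * a) (by rw [hx]; linarith)
  have hq := hlog (-(2 * a)) (by rw [abs_neg, hx]; linarith)
  rw [hx, abs_le] at hp
  rw [abs_neg, hx, abs_le] at hq
  have e1 : Real.log (1 / 2 - a) = Real.log (1 - 2 * a) - Real.log 2 := by
    rw [← Real.log_div (by linarith) two_ne_zero]
    congr 1
    ring
  have e2 : Real.log (1 - (1 / 2 - a)) = Real.log (1 - -(2 * a)) - Real.log 2 := by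
    rw [← Real.log_div (by linarith) two_ne_zero]
    congr 1
    ring
  -- The logarithms of `1 ∓ 2a` carry the whole expansion; their quadratic Taylor errors are each at
  -- most `2(2a)³ = 16a³`, and the weights `1/2 ∓ a` sum to 1.
  have e3 : Real.log 2 - Real.binEntropy (1 / 2 - a) =
      (1 / 2 - a) * Real.log (1 - 2 * a) + (1 / 2 + a) * Real.log (1 - -(2 * a)) := by
    rw [Real.binEntropy, Real.log_inv, Real.log_inv, e1, e2]
    ring
  rw [e3]
  generalize Real.log (1 - 2 * a) = p at *
  generalize Real.log (1 - -(2 * a)) = q at *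
  have ha1 : 0 ≤ 1 / 2 - a := by linarith
  have ha2 : 0 ≤ 1 / 2 + a := by linarith
  rw [abs_le]
  constructor
  · have := mul_le_mul_of_nonneg_left hp.1 ha1
    have := mul_le_mul_of_nonneg_left hq.1 ha2
    nlinarith
  · have := mul_le_mul_of_nonneg_left hp.2 ha1
    have := mul_le_mul_of_nonneg_left hq.2 ha2
    nlinarith

/-- `H₂` is strictly increasing on `[0, 1/2]` and below 1 at `1/2 - δ`, so values close enough to 1
have their preimage within `δ` of `1/2`. This makes the local expansion applicable below. -/
theorem tendsto_half_sub_H₂inv :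
    Tendsto (fun t => 1 / 2 - H₂inv (1 - t)) (𝓝[>] 0) (𝓝 0) := by
  have hdom : ∀ᶠ t : ℝ in 𝓝[>] 0, t ∈ Set.Ioo (0 : ℝ) 1 := Ioo_mem_nhdsGT one_pos
  rw [Metric.tendsto_nhds]
  intro ε hε
  set δ := min ε (1 / 2) with hδ
  have hδ0 : 0 < δ := lt_min hε (by norm_num)
  have hδ1 : δ ≤ 1 / 2 := min_le_right _ _
  have hlt : H₂ (1 / 2 - δ) < 1 := by
    rw [H₂, div_lt_one (Real.log_pos one_lt_two), Real.binEntropy_lt_log_two]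
    intro h
    norm_num at h
    exact hδ0.ne' h
  filter_upwards [hdom, Ioo_mem_nhdsGT (sub_pos.mpr hlt)] with t ht ht'
  obtain ⟨h1, h2⟩ := H₂inv_spec (y := 1 - t) ⟨by linarith [ht.2], by linarith [ht.1]⟩
  have h3 : 1 / 2 - δ < H₂inv (1 - t) := by
    rw [← H₂_strictMonoOn.lt_iff_lt ⟨by linarith, by linarith⟩ h1, h2]
    linarith [ht'.2]
  rw [Real.dist_eq, sub_zero, abs_of_nonneg (by linarith [h1.2])]
  have : δ ≤ ε := min_le_left _ _
  linarith

/-- `H₂⁻¹ (1 - t) = 1 / 2 - (1 + o(1)) √(t log 2 / 2)` as `t → 0`. -/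
theorem tendsto_half_sub_H₂inv_div_sqrt :
    Tendsto (fun t => (1 / 2 - H₂inv (1 - t)) / Real.sqrt (t * Real.log 2 / 2))
      (𝓝[>] 0) (𝓝 1) := by
  have hl := Real.log_pos one_lt_two
  set a : ℝ → ℝ := fun t => 1 / 2 - H₂inv (1 - t) with ha
  have ha0 : Tendsto a (𝓝[>] 0) (𝓝 0) := tendsto_half_sub_H₂inv
  have hinv : Tendsto (fun t => t * Real.log 2 / 2 / a t ^ 2) (𝓝[>] 0) (𝓝 1) := by
    rw [tendsto_iff_dist_tendsto_zero]
    -- The cubic remainder `16a³` divided by `2a²` leaves an error of `8a`.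
    refine squeeze_zero' (Eventually.of_forall fun _ => dist_nonneg) ?_
      (by simpa using ha0.const_mul 8)
    filter_upwards [Ioo_mem_nhdsGT (one_pos : (0 : ℝ) < 1),
      ha0.eventually (gt_mem_nhds (by norm_num : (0 : ℝ) < 1 / 4))] with t ht hlt
    obtain ⟨h1, h2⟩ := H₂inv_spec (y := 1 - t) ⟨by linarith [ht.2], by linarith [ht.1]⟩
    have hx : H₂inv (1 - t) = 1 / 2 - a t := by rw [ha]; ring
    rw [hx, H₂, div_eq_iff hl.ne'] at h2
    have hat : 0 ≤ a t := sub_nonneg.mpr h1.2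
    have hne : a t ≠ 0 := by
      intro h
      rw [h, sub_zero, one_div, Real.binEntropy_two_inv] at h2
      nlinarith [ht.1]
    have hpos : 0 < a t := lt_of_le_of_ne hat hne.symm
    have h := abs_log_two_sub_binEntropy_sub_le hat hlt.le
    rw [h2] at h
    have e : t * Real.log 2 / 2 / a t ^ 2 - 1 =
        (Real.log 2 - (1 - t) * Real.log 2 - 2 * a t ^ 2) / (2 * a t ^ 2) := by
      field_simp
      ring
    rw [Real.dist_eq, e, abs_div, abs_of_pos (by positivity : 0 < 2 * a t ^ 2),
      div_le_iff₀ (by positivity)]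
    linarith
  have h := (hinv.inv₀ one_ne_zero).sqrt
  rw [inv_one, Real.sqrt_one] at h
  refine h.congr' ?_
  filter_upwards [Ioo_mem_nhdsGT (one_pos : (0 : ℝ) < 1)] with t ht
  obtain ⟨h1, -⟩ := H₂inv_spec (y := 1 - t) ⟨by linarith [ht.2], by linarith [ht.1]⟩
  have hat : 0 ≤ a t := sub_nonneg.mpr h1.2
  rw [inv_div, Real.sqrt_div (sq_nonneg _), Real.sqrt_sq hat]

theorem tendsto_log_div_natCast (b : ℝ) (hb : 0 < b) :
    Tendsto (fun k : ℕ => b * Real.log k / k) atTop (𝓝[>] 0) := by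
  refine tendsto_nhdsWithin_iff.mpr ⟨?_, ?_⟩
  · have h := (Real.isLittleO_log_id_atTop.tendsto_div_nhds_zero.comp
      tendsto_natCast_atTop_atTop).const_mul b
    rw [mul_zero] at h
    refine h.congr fun k => ?_
    simp [mul_div_assoc]
  · filter_upwards [eventually_ge_atTop 2] with k hk
    have h2 : (1 : ℝ) < k := by exact_mod_cast hk
    have := Real.log_pos h2
    exact Set.mem_Ioi.mpr (by positivity)

end DQI

/-! ### Choice of the error sequences and comparison of scales -/

theorem mainTheorem1 (lam : ℝ) (hlam : 1 < lam) (c : ℝ) (hc : 1 ≤ c)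
    (ε₁ : ℕ → ℝ) (hε₁ : Tendsto ε₁ atTop (𝓝 0)) :
    ∃ ε₂ ε₃ : ℕ → ℝ, Tendsto ε₂ atTop (𝓝 0) ∧ Tendsto ε₃ atTop (𝓝 0) ∧
      ∀ k d : ℕ, 3 ≤ k → (d : ℝ) = lam * k → c ≤ k * lam →
        ∃ μ : ℝ,
          (1 + ε₂ k) * (4 * c * Real.logb 2 k / (k * lam)) ∈ Set.Icc (0 : ℝ) 1 ∧
          μ = 1 - DQI.H₂inv (1 - (1 + ε₂ k) * (4 * c * Real.logb 2 k / (k * lam))) ∧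
          μ = 1 / 2 + (1 + ε₃ k) * Real.sqrt (2 * c * Real.log k / (k * lam)) ∧
          ∃ n₀ : ℕ, ∀ N : ℕ, n₀ ≤ k * N → ∀ ℓ : ℕ, ℓ ≤ d * N →
            (ℓ : ℝ) / ((d * N : ℕ) : ℝ) ≤ (1 + ε₁ k) * DQI.H₂inv (c / (k * lam)) →
            ∀ w : ℕ → ℝ, ∑ j ∈ Finset.range (ℓ + 1), w j ^ 2 = 1 →
            ∀ D : Matrix (Fin k × Fin N) (Fin (d * N)) (ZMod 2) →
                (Fin k × Fin N → ZMod 2) → (Fin (d * N) → ZMod 2),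
              DQI.successProb k d N ℓ w D μ ≤ 12 / 13 := by
  have hl := Real.log_pos one_lt_two
  have hlam0 : 0 < lam := by linarith
  have hc0 : 0 < c := by linarith
  set t : ℕ → ℝ := fun k => 4 * c * Real.logb 2 k / (k * lam) with ht
  set s : ℕ → ℝ := fun k => Real.sqrt (2 * c * Real.log k / (k * lam)) with hs
  have hts : ∀ k, s k = Real.sqrt (t k * Real.log 2 / 2) := by
    intro k
    simp only [hs, ht, Real.logb]
    congr 1
    field_simp
    ring
  have htt : Tendsto t atTop (𝓝[>] 0) := by
    refine (DQI.tendsto_log_div_natCast (4 * c / (Real.log 2 * lam)) (by positivity)).congr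
      fun k => ?_
    simp only [ht, Real.logb]
    field_simp
  have hratio : Tendsto (fun k => (1 / 2 - DQI.H₂inv (1 - t k)) / s k) atTop (𝓝 1) := by
    simp only [hts]
    exact DQI.tendsto_half_sub_H₂inv_div_sqrt.comp htt
  -- Four eventual conditions: the argument of `H₂⁻¹` is in range, `1 + ε₁ ≤ 2`, `ln k` beats the
  -- constants, and `μ - 1/2` is at least half its asymptotic value.
  set large : ℕ → Prop := fun k => t k ≤ 1 ∧ ε₁ k ≤ 1 ∧ 8 ≤ Real.log k ∧
    1 / 2 ≤ (1 / 2 - DQI.H₂inv (1 - t k)) / s k with hlarge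
  have hev : ∀ᶠ k in atTop, large k := by
    have h1 := (htt.mono_right nhdsWithin_le_nhds).eventually
      (ge_mem_nhds (zero_lt_one : (0 : ℝ) < 1))
    have h2 := hε₁.eventually (ge_mem_nhds (zero_lt_one : (0 : ℝ) < 1))
    have h3 := (Real.tendsto_log_atTop.comp tendsto_natCast_atTop_atTop).eventually_ge_atTop 8
    have h4 := hratio.eventually (le_mem_nhds (by norm_num : (1 / 2 : ℝ) < 1))
    filter_upwards [h1, h2, h3, h4] with k h1 h2 h3 h4
    exact ⟨h1, h2, h3, h4⟩
  classical
  -- Outside `large`, this value makes `(1 + ε₂ k) * t k = 1`, hence `μ = 1 - H₂⁻¹(0) = 1`.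
  set ε₂ : ℕ → ℝ := fun k => if large k then 0 else (t k)⁻¹ - 1 with hε₂
  set ν : ℕ → ℝ := fun k => 1 - DQI.H₂inv (1 - (1 + ε₂ k) * t k) with hν
  have hε₂_large : ∀ k, large k → ε₂ k = 0 := fun k hk => by simp only [hε₂, if_pos hk]
  have hν_large : ∀ k, large k → ν k - 1 / 2 = 1 / 2 - DQI.H₂inv (1 - t k) := by
    intro k hk
    simp only [hν]
    rw [hε₂_large k hk, add_zero, one_mul]
    ring
  -- `ε₃` is solved for from the second formula for `μ`; its limit is the square-root asymptotics of
  -- `H₂⁻¹` near 1.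
  refine ⟨ε₂, fun k => (ν k - 1 / 2) / s k - 1, ?_, ?_, ?_⟩
  · refine tendsto_const_nhds.congr' ?_
    filter_upwards [hev] with k hk
    exact (hε₂_large k hk).symm
  · have h := hratio.sub_const 1
    rw [sub_self] at h
    refine h.congr' ?_
    filter_upwards [hev] with k hk
    rw [hν_large k hk]
  · intro k d hk hd hck
    have hk1 : (1 : ℝ) < k := by exact_mod_cast (by omega : 1 < k)
    have hk0 : (0 : ℝ) < k := by linarith
    have hlogk := Real.log_pos hk1
    have hrad : 0 < 2 * c * Real.log k / (k * lam) := by positivity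
    have hs0 : 0 < s k := Real.sqrt_pos.mpr hrad
    have hs2 : s k ^ 2 = 2 * c * Real.log k / (k * lam) := Real.sq_sqrt hrad.le
    have ht0 : 0 < t k := by
      have := Real.logb_pos one_lt_two hk1
      simp only [ht]
      positivity
    refine ⟨ν k, ?_, rfl, ?_, ?_⟩
    · change (1 + ε₂ k) * t k ∈ Set.Icc (0 : ℝ) 1
      by_cases hL : large k
      · rw [hε₂_large k hL, add_zero, one_mul]
        exact ⟨ht0.le, hL.1⟩
      · simp only [hε₂, if_neg hL, add_sub_cancel]
        rw [inv_mul_cancel₀ ht0.ne']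
        norm_num
    · change ν k = 1 / 2 + (1 + ((ν k - 1 / 2) / s k - 1)) * s k
      field_simp
      ring
    by_cases hL : large k
    · obtain ⟨-, hε, hlog8, hhalf⟩ := id hL
      rw [← hν_large k hL, le_div_iff₀ hs0] at hhalf
      set α := ν k - 1 / 2 with hα
      have hα0 : 0 < α := by linarith
      have hα2 : c * Real.log k / (2 * (k * lam)) ≤ α ^ 2 := by
        have h := pow_le_pow_left₀ (by positivity) hhalf 2
        rw [mul_pow, hs2] at h
        refine le_trans (le_of_eq ?_) h
        field_simp
      -- With `m ≥ n` from `λ > 1`, this gives `m ≥ 4/α²`, so the `+1` in `ℓ + 1` costs at most `α²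
      -- m / 4`.
      refine ⟨⌈4 / α ^ 2⌉₊ + 1, fun N hN ℓ hℓ hℓm w hw D => ?_⟩
      have hdN : ((k * N : ℕ) : ℝ) ≤ ((d * N : ℕ) : ℝ) := by
        push_cast
        rw [hd]
        have : (0 : ℝ) ≤ N := Nat.cast_nonneg N
        nlinarith [mul_nonneg hk0.le this]
      have hm4 : 4 / α ^ 2 ≤ ((d * N : ℕ) : ℝ) := by
        refine (Nat.le_ceil _).trans (le_trans ?_ hdN)
        exact_mod_cast (Nat.le_succ _).trans hN
      have hm0 : (0 : ℝ) < ((d * N : ℕ) : ℝ) := lt_of_lt_of_le (by positivity) hm4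
      refine (DQI.successProb_le hℓ (Nat.cast_pos.mp hm0) hw D (by linarith)).trans ?_
      rw [← hα]
      generalize ((d * N : ℕ) : ℝ) = M at *
      have hq : c / (k * lam) ∈ Set.Icc (0 : ℝ) 1 :=
        ⟨by positivity, div_le_one_of_le₀ hck (by positivity)⟩
      have hℓ2 : (ℓ : ℝ) / M ≤ 2 * (c / (k * lam)) := by
        refine hℓm.trans (mul_le_mul (by linarith) (DQI.H₂inv_le hq) ?_ (by norm_num))
        exact (DQI.H₂inv_spec hq).1.1
      rw [div_le_iff₀ hm0] at hℓ2
      rw [div_le_iff₀ (by positivity)] at hm4 ⊢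
      have h1 : 4 * (c / (k * lam)) ≤ α ^ 2 := by
        refine le_trans ?_ hα2
        have e : c * Real.log k / (2 * (k * lam)) = c / (k * lam) * (Real.log k / 2) := by
          field_simp
        rw [e, mul_comm]
        exact mul_le_mul_of_nonneg_left (by linarith) hq.1
      -- Here `ℓ ≤ α² M / 2` and `1 ≤ α² M / 4`, so the bound is in fact `3/4`, below `12/13`.
      nlinarith [mul_le_mul_of_nonneg_right h1 hm0.le]
    · refine ⟨0, fun N _ ℓ _ _ w _ D => ?_⟩
      have hν1 : ν k = 1 := by
        simp only [hν, hε₂, if_neg hL, add_sub_cancel]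
        rw [inv_mul_cancel₀ ht0.ne', sub_self, DQI.H₂inv_zero, sub_zero]
      rw [hν1, DQI.successProb_eq_zero D le_rfl]
      norm_num
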